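/- **Setting.** Let $r\ge 3$, and let $$\Delta_{B_r}=\{\pm\epsilon_i\pm\epsilon_j: 1\le i\ne j\le r\}\cup\{\pm\epsilon_i: 1\le i\le r\},\qquad \Delta=\Delta_{B_r}\cup\{\pm2\epsilon_i: 1\le i\le r\}$$ be the root systems of types $B_r$ and $BC_r$ in the lattice $\Gamma=\bigoplus_{i=1}^r\mathbb Z\epsilon_i$, where $\epsilon_1,\dots,\epsilon_r$ is orthonormal for $(\cdot,\cdot)$. Let $(\alpha_1,\dots,\alpha_r)$ be an ordered base of $\Delta_{B_r}$, let $d\ge 0$, and let $\alpha_{r+1},\dots,\alpha_{r+d}$ be any long roots $\pm\epsilon_i\pm\epsilon_j$ ($i\neq j$) of $\Delta_{B_r}$, repetitions allowed. Let $A^{[d]}$ be the $(r+d)\times(r+d)$ integer matrix with entries $M_{ij}=2(\alpha_i,\alpha_j)/(\alpha_i,\alpha_i)$. Let $\mathfrak{gim}(A^{[d]})$ be the Lie algebra over $\mathbb C$ with generators $e_i,f_i,h_i$ ($1\le i\le r+d$) and the relations * $[h_i,e_j]=M_{ij}e_j$, $[h_i,f_j]=-M_{ij}f_j$, $[e_i,f_i]=h_i$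 for all $i,j$; * $[e_i,f_j]=0=[f_i,e_j]$ and $(\operatorname{ad}e_i)^{-M_{ij}+1}e_j=0=(\operatorname{ad}f_i)^{-M_{ij}+1}f_j$ whenever $M_{ij}\le 0$; * $[e_i,e_j]=0=[f_i,f_j]$ and $(\operatorname{ad}e_i)^{M_{ij}+1}f_j=0=(\operatorname{ad}f_i)^{M_{ij}+1}e_j$ whenever $M_{ij}>0$ and $i\ne j$. It is $\Gamma$-graded by $\deg e_i=\alpha_i=-\deg f_i$, $\deg h_i=0$. Let $\mathfrak r$ be the ideal generated by the homogeneous components $\mathfrak{gim}(A^{[d]})_\gamma$ with $\gamma\notin\Delta\cup\{0\}$. The intersection matrix algebra is $\mathfrak{im}(A^{[d]})=\mathfrak{gim}(A^{[d]})/\mathfrak r$. **Theorem.** The Lie algebra $\mathfrak{im}(A^{[d]})$ is centrally closed, i.e. it is, with the identity map, its own universal covering algebra: $\mathfrak{im}(A^{[d]})$ is perfect, and for every surjective homomorphism of complex Lie algebras $\psi:E\to\mathfrak{im}(A^{[d]})$ with central kernel there is exactly one Lie algebra homomorphism $\theta:\mathfrak{im}(A^{[d]})\to E$ with $\psi\circ\theta=\mathrm{id}$.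 -/

import Mathlib

universe u v w

namespace IntersectionMatrix

/-! ### Root systems of type `B_r` and `BC_r`, in the lattice `ℤ^r` with basis `ε_1, …, ε_r` -/

section Roots

variable {r : ℕ}

/-- The long roots `±ε_i ± ε_j`, `i ≠ j`, of the root system of type `B_r`. -/
def longRoots (r : ℕ) : Set (Fin r → ℤ) :=
  {x | ∃ (i j : Fin r) (s t : ℤˣ), i ≠ j ∧ x = Pi.single i (s : ℤ) + Pi.single j (t : ℤ)}

/-- The short roots `±ε_i` of the root system of type `B_r`. -/
def shortRoots (r : ℕ) : Set (Fin r → ℤ) :=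
  {x | ∃ (i : Fin r) (s : ℤˣ), x = Pi.single i (s : ℤ)}

/-- The vectors `±2ε_i`. -/
def extraLongRoots (r : ℕ) : Set (Fin r → ℤ) :=
  {x | ∃ (i : Fin r) (s : ℤˣ), x = Pi.single i (2 * (s : ℤ))}

/-- The root system of type `B_r`. -/
def rootsB (r : ℕ) : Set (Fin r → ℤ) := longRoots r ∪ shortRoots r

/-- The root system of type `BC_r`. -/
def rootsBC (r : ℕ) : Set (Fin r → ℤ) := longRoots r ∪ shortRoots r ∪ extraLongRoots r

/-- `α = (α_1, …, α_r)` is an ordered base (a system of simple roots) of the root system of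
type `B_r`: the `α_i` are linearly independent roots, and every root is a combination of them
with non-negative integer coefficients, or the negative of such a combination. -/
structure IsBase (α : Fin r → Fin r → ℤ) : Prop where
  mem : ∀ i, α i ∈ rootsB r
  linearIndependent : LinearIndependent ℤ α
  mem_or_neg_mem : ∀ x ∈ rootsB r,
    x ∈ AddSubmonoid.closure (Set.range α) ∨ -x ∈ AddSubmonoid.closure (Set.range α)

/-- The Cartan integer `2 (x, y) / (x, x)`. The form is the standard one on `ℤ^r`; the form induced
by the Killing form is a scalar multiple of it, and the quotient does not see the scalar.
The division is exact when `x` is a root, see `cartanInt_mul_self`. -/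
def cartanInt (x y : Fin r → ℤ) : ℤ := 2 * (x ⬝ᵥ y) / (x ⬝ᵥ x)

lemma cartanInt_mul_self {x : Fin r → ℤ} (hx : x ∈ rootsB r) (y : Fin r → ℤ) :
    cartanInt x y * (x ⬝ᵥ x) = 2 * (x ⬝ᵥ y) := by
  have key : x ⬝ᵥ x = 2 ∨ x ⬝ᵥ x = 1 := by
    rcases hx with ⟨i, j, s, t, hij, rfl⟩ | ⟨i, s, rfl⟩
    · left
      rcases Int.units_eq_one_or s with rfl | rfl <;>
        rcases Int.units_eq_one_or t with rfl | rfl <;> simp [hij, hij.symm]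
    · right
      rcases Int.units_eq_one_or s with rfl | rfl <;> simp
  unfold cartanInt
  rcases key with h | h <;> rw [h] <;> omega

/-- The matrix with entries `2 (ρ_i, ρ_j) / (ρ_i, ρ_i)` attached to a family `ρ` of roots. -/
def cartanIntMatrix {ι : Type} (ρ : ι → Fin r → ℤ) : Matrix ι ι ℤ :=
  fun i j => cartanInt (ρ i) (ρ j)

end Roots

/-! ### Generalized intersection matrix algebras -/

section GIM

variable {ι : Type}

/-- The generators `e_i`, `f_i`, `h_i`. -/
inductive Gen (ι : Type) : Type
  | e : ι → Gen ι
  | f : ι → Gen ι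
  | h : ι → Gen ι

/-- The generator `e_i` of the free Lie algebra. -/
noncomputable abbrev freeE (i : ι) : FreeLieAlgebra ℂ (Gen ι) := FreeLieAlgebra.of ℂ (Gen.e i)

/-- The generator `f_i` of the free Lie algebra. -/
noncomputable abbrev freeF (i : ι) : FreeLieAlgebra ℂ (Gen ι) := FreeLieAlgebra.of ℂ (Gen.f i)

/-- The generator `h_i` of the free Lie algebra. -/
noncomputable abbrev freeH (i : ι) : FreeLieAlgebra ℂ (Gen ι) := FreeLieAlgebra.of ℂ (Gen.h i)

/-- The adjoint action on the free Lie algebra. -/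
noncomputable abbrev freeAd (x : FreeLieAlgebra ℂ (Gen ι)) :
    Module.End ℂ (FreeLieAlgebra ℂ (Gen ι)) :=
  LieAlgebra.ad ℂ (FreeLieAlgebra ℂ (Gen ι)) x

/-- The elements of the free Lie algebra on the `e_i`, `f_i`, `h_i` that the defining relations of
the generalized intersection matrix algebra of `M` set to zero. -/
inductive IsRelator (M : Matrix ι ι ℤ) : FreeLieAlgebra ℂ (Gen ι) → Prop
  | he (i j : ι) : IsRelator M (⁅freeH i, freeE j⁆ - (M i j : ℂ) • freeE j)
  | hf (i j : ι) : IsRelator M (⁅freeH i, freeF j⁆ + (M i j : ℂ) • freeF j)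
  | ef (i : ι) : IsRelator M (⁅freeE i, freeF i⁆ - freeH i)
  | neg_ef (i j : ι) (hM : M i j ≤ 0) : IsRelator M ⁅freeE i, freeF j⁆
  | neg_fe (i j : ι) (hM : M i j ≤ 0) : IsRelator M ⁅freeF i, freeE j⁆
  | neg_ad_e (i j : ι) (hM : M i j ≤ 0) : IsRelator M ((freeAd (freeE i) ^ (-M i j + 1).toNat) (freeE j))
  | neg_ad_f (i j : ι) (hM : M i j ≤ 0) : IsRelator M ((freeAd (freeF i) ^ (-M i j + 1).toNat) (freeF j))
  | pos_ee (i j : ι) (hM : 0 < M i j) (hij : i ≠ j) : IsRelator M ⁅freeE i, freeE j⁆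
  | pos_ff (i j : ι) (hM : 0 < M i j) (hij : i ≠ j) : IsRelator M ⁅freeF i, freeF j⁆
  | pos_ad_e (i j : ι) (hM : 0 < M i j) (hij : i ≠ j) :
      IsRelator M ((freeAd (freeE i) ^ (M i j + 1).toNat) (freeF j))
  | pos_ad_f (i j : ι) (hM : 0 < M i j) (hij : i ≠ j) :
      IsRelator M ((freeAd (freeF i) ^ (M i j + 1).toNat) (freeE j))

/-- The ideal of the free Lie algebra generated by the defining relations. -/
noncomputable def relationIdeal (M : Matrix ι ι ℤ) : LieIdeal ℂ (FreeLieAlgebra ℂ (Gen ι)) :=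
  LieSubmodule.lieSpan ℂ (FreeLieAlgebra ℂ (Gen ι)) {x | IsRelator M x}

/-- The generalized intersection matrix algebra `gim(M)`, over `ℂ`. -/
abbrev GIM (M : Matrix ι ι ℤ) : Type := FreeLieAlgebra ℂ (Gen ι) ⧸ relationIdeal M

/-- The class in `gim(M)` of a generator. -/
noncomputable def GIM.gen (M : Matrix ι ι ℤ) (g : Gen ι) : GIM M :=
  LieSubmodule.Quotient.mk (FreeLieAlgebra.of ℂ g)

variable {r : ℕ} (ρ : ι → Fin r → ℤ)

/-- The degree of a generator: `deg e_i = ρ_i = - deg f_i` and `deg h_i = 0`. -/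
def Gen.degree : Gen ι → Fin r → ℤ
  | .e i => ρ i
  | .f i => -ρ i
  | .h _ => 0

/-- `IsMonomial ρ M γ x` says that `x` is an iterated bracket of generators of `gim(M)` whose
degrees add up to `γ`. -/
inductive IsMonomial (M : Matrix ι ι ℤ) : (Fin r → ℤ) → GIM M → Prop
  | gen (g : Gen ι) : IsMonomial M (g.degree ρ) (GIM.gen M g)
  | lie {γ δ : Fin r → ℤ} {x y : GIM M} (hx : IsMonomial M γ x) (hy : IsMonomial M δ y) :
      IsMonomial M (γ + δ) ⁅x, y⁆

/-- The homogeneous component `gim(M)_γ` of degree `γ`, where the generators have the degrees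
`deg e_i = ρ_i = - deg f_i` and `deg h_i = 0`. -/
noncomputable def homogeneousPart (M : Matrix ι ι ℤ) (γ : Fin r → ℤ) : Submodule ℂ (GIM M) :=
  Submodule.span ℂ {x | IsMonomial ρ M γ x}

/-- The radical of the `gim` algebra attached to a family of roots: the ideal generated by
the homogeneous components whose degree is neither `0` nor a root of type `BC_r`. -/
noncomputable def radical : LieIdeal ℂ (GIM (cartanIntMatrix ρ)) :=
  LieSubmodule.lieSpan ℂ (GIM (cartanIntMatrix ρ))
    {x | ∃ γ : Fin r → ℤ, γ ∉ rootsBC r ∪ {0} ∧ x ∈ homogeneousPart ρ (cartanIntMatrix ρ) γ}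

/-- The intersection matrix algebra attached to a family of roots. -/
abbrev IM : Type := GIM (cartanIntMatrix ρ) ⧸ radical ρ

end GIM

/-! ### Central extensions and universal covering algebras -/

section Covering

variable {K : Type u} {L : Type v}
variable [LieRing K] [LieAlgebra ℂ K] [LieRing L] [LieAlgebra ℂ L]

/-- A central extension of `L`: a surjective homomorphism onto `L` with central kernel. -/
structure IsCentralExtension (φ : K →ₗ⁅ℂ⁆ L) : Prop where
  surjective : Function.Surjective φ
  ker_le_center : φ.ker ≤ LieAlgebra.center ℂ K

/-- `φ : K → L` is a universal covering algebra of `L`: it is a central extension with `K` perfect,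
through which every central extension of `L` (in the universe `w`) factors uniquely. -/
structure IsUniversalCovering (φ : K →ₗ⁅ℂ⁆ L) : Prop where
  perfect : ⁅(⊤ : LieIdeal ℂ K), (⊤ : LieIdeal ℂ K)⁆ = ⊤
  isCentralExtension : IsCentralExtension φ
  existsUnique_lift : ∀ (E : Type w) [LieRing E] [LieAlgebra ℂ E] (ψ : E →ₗ⁅ℂ⁆ L),
    IsCentralExtension ψ → ∃! θ : K →ₗ⁅ℂ⁆ E, ψ.comp θ = φ

/-- `L` is centrally closed: it is its own universal covering algebra. -/
def IsCentrallyClosed (L : Type v) [LieRing L] [LieAlgebra ℂ L] : Prop :=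
  IsUniversalCovering.{v, v, w} (LieHom.id : L →ₗ⁅ℂ⁆ L)

end Covering

end IntersectionMatrix

/-! Let `ψ : E → im` be a central extension. The mechanism is that an eigenvector in `E` with
nonzero eigenvalue under some `ad x` vanishes as soon as `ψ` kills it: being in the kernel it is
central, so `ad x` also sends it to zero (`IsCentralExtension.eq_zero_of_lie_eq_smul`).

The generators of `im` lift to elements of `E` satisfying the relations that involve the `h_i`
(`CartanRelations.exists_lift`). The lifted `h_i` then act on iterated brackets through the degree.
Each remaining relator is homogeneous of a degree on which some `h_i` has a nonzero eigenvalue, and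
`ψ` kills its image, so it already vanishes in `E` (`map_relator_eq_zero`). The same holds for the
components generating the radical: their degrees are nonzero, and a base of `B_r` separates nonzero
vectors from zero (`IsBase.exists_cartanInt_ne_zero`). Hence the lift factors through `im` and
splits `ψ` (`IM.exists_section`). The splitting is unique because `im` is perfect. -/

namespace IntersectionMatrix

/-! ### Quotients of Lie algebras by ideals -/

section Quotient

variable {R L L' : Type*} [CommRing R] [LieRing L] [LieAlgebra R L] [LieRing L'] [LieAlgebra R L']

/-- The projection of a Lie algebra onto its quotient by an ideal, as a homomorphism. -/
def quotientMk (I : LieIdeal R L) : L →ₗ⁅R⁆ L ⧸ I :=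
  { I.toSubmodule.mkQ with map_lie' := rfl }

lemma quotientMk_surjective (I : LieIdeal R L) : Function.Surjective (quotientMk I) :=
  Quot.mk_surjective

lemma quotientMk_eq_zero {I : LieIdeal R L} {x : L} : quotientMk I x = 0 ↔ x ∈ I :=
  Submodule.Quotient.mk_eq_zero I.toSubmodule

/-- A homomorphism that vanishes on an ideal factors through the quotient. -/
def quotientLift (I : LieIdeal R L) (f : L →ₗ⁅R⁆ L') (h : I ≤ f.ker) : L ⧸ I →ₗ⁅R⁆ L' :=
  { I.toSubmodule.liftQ (f : L →ₗ[R] L') (fun x hx => (LieHom.mem_ker).1 (h hx)) with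
    map_lie' := by
      intro x y
      obtain ⟨x, rfl⟩ := quotientMk_surjective I x
      obtain ⟨y, rfl⟩ := quotientMk_surjective I y
      exact f.map_lie x y }

end Quotient

/-! ### Central extensions -/

section Central

variable {E : Type u} {L : Type v} [LieRing E] [LieAlgebra ℂ E] [LieRing L] [LieAlgebra ℂ L]
variable {ψ : E →ₗ⁅ℂ⁆ L}

lemma IsCentralExtension.lie_eq_zero_right (hψ : IsCentralExtension ψ) {z : E} (hz : ψ z = 0)
    (x : E) : ⁅x, z⁆ = 0 :=
  (LieModule.mem_maxTrivSubmodule ℂ E E z).1 (hψ.ker_le_center (LieHom.mem_ker.2 hz)) x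

lemma IsCentralExtension.lie_congr_right (hψ : IsCentralExtension ψ) {y y' : E}
    (h : ψ y = ψ y') (x : E) : ⁅x, y⁆ = ⁅x, y'⁆ := by
  rw [← sub_eq_zero, ← lie_sub]
  exact hψ.lie_eq_zero_right (by rw [map_sub, h, sub_self]) x

/-- The bracket of `E` descends to a map from `L × L` to `E`, so a bracket of lifts does not depend
on the lifts chosen. -/
lemma IsCentralExtension.lie_congr (hψ : IsCentralExtension ψ) {x x' y y' : E}
    (hx : ψ x = ψ x') (hy : ψ y = ψ y') : ⁅x, y⁆ = ⁅x', y'⁆ := by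
  rw [hψ.lie_congr_right hy, ← lie_skew, hψ.lie_congr_right hx, lie_skew]

lemma IsCentralExtension.eq_zero_of_lie_eq_smul (hψ : IsCentralExtension ψ) {x z : E} {c : ℂ}
    (hc : c ≠ 0) (h : ⁅x, z⁆ = c • z) (hz : ψ z = 0) : z = 0 := by
  rw [hψ.lie_eq_zero_right hz] at h
  exact (smul_eq_zero.1 h.symm).resolve_left hc

/-- Two lifts of a homomorphism from a perfect Lie algebra to a central extension agree. -/
lemma IsCentralExtension.lift_unique (hψ : IsCentralExtension ψ) {K : Type*} [LieRing K]
    [LieAlgebra ℂ K] (hK : ⁅(⊤ : LieIdeal ℂ K), (⊤ : LieIdeal ℂ K)⁆ = ⊤) {θ θ' : K →ₗ⁅ℂ⁆ E}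
    (h : ψ.comp θ = ψ.comp θ') : θ = θ' := by
  ext x
  have hx : x ∈ (⁅(⊤ : LieIdeal ℂ K), (⊤ : LieIdeal ℂ K)⁆ : LieIdeal ℂ K) := by
    rw [hK]; exact LieSubmodule.mem_top x
  rw [← LieSubmodule.mem_toSubmodule, LieSubmodule.lieIdeal_oper_eq_linear_span'] at hx
  induction hx using Submodule.span_induction with
  | mem x hx =>
    obtain ⟨a, -, b, -, rfl⟩ := hx
    rw [LieHom.map_lie, LieHom.map_lie]
    exact hψ.lie_congr (LieHom.congr_fun h a) (LieHom.congr_fun h b)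
  | zero => simp
  | add x y _ _ hx hy => rw [map_add, map_add, hx, hy]
  | smul c x _ hx => rw [map_smul, map_smul, hx]

end Central

/-! ### Families satisfying the relations that involve the `h_i` -/

section Chevalley

variable {ι : Type} {E : Type u} {L : Type v} [LieRing E] [LieAlgebra ℂ E] [LieRing L]
  [LieAlgebra ℂ L]

/-- The relations of `gim(M)` that involve the `h_i`. -/
structure CartanRelations (M : Matrix ι ι ℤ) (g : Gen ι → L) : Prop where
  lie_h_e : ∀ i j, ⁅g (.h i), g (.e j)⁆ = (M i j : ℂ) • g (.e j)
  lie_h_f : ∀ i j, ⁅g (.h i), g (.f j)⁆ = -(M i j : ℂ) • g (.f j)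
  lie_e_f : ∀ i, ⁅g (.e i), g (.f i)⁆ = g (.h i)

/-- Write `h_j` as `[e_j, f_j]`: the eigenvalues of `h_i` on `e_j` and `f_j` are opposite and cancel
in the Leibniz rule. -/
lemma CartanRelations.lie_h_h {M : Matrix ι ι ℤ} {g : Gen ι → L} (hg : CartanRelations M g)
    (i j : ι) : ⁅g (.h i), g (.h j)⁆ = 0 := by
  rw [← hg.lie_e_f j, leibniz_lie, hg.lie_h_e, hg.lie_h_f]
  simp

/-- A lift of an eigenvector to a central extension can be corrected to an eigenvector for a
commuting family. -/
lemma IsCentralExtension.exists_lift_eigenvector {ψ : E →ₗ⁅ℂ⁆ L} (hψ : IsCentralExtension ψ)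
    {h : ι → E} (hh : ∀ i j, ψ ⁅h i, h j⁆ = 0) {x : L} {c : ι → ℂ} (hx : ∀ i, ⁅ψ (h i), x⁆ = c i • x)
    {j : ι} (hj : c j ≠ 0) : ∃ y : E, ψ y = x ∧ ∀ i, ⁅h i, y⁆ = c i • y := by
  obtain ⟨y₀, rfl⟩ := hψ.surjective x
  have hy : ψ ((c j)⁻¹ • ⁅h j, y₀⁆) = ψ y₀ := by
    rw [map_smul, LieHom.map_lie, hx, inv_smul_smul₀ hj]
  -- `y` and `y₀` have the same image, so `h_j` has the same bracket with both; that bracket is `c j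
  -- • y` by the choice of `y`.
  set y := (c j)⁻¹ • ⁅h j, y₀⁆ with hydef
  have hjy : ⁅h j, y⁆ = c j • y := by
    rw [hψ.lie_congr_right hy, hydef, smul_inv_smul₀ hj]
  clear_value y
  -- For any `i`, the defect `[h_i, y] - c_i y` lies in the kernel of `ψ`. It is also an eigenvector
  -- of `h_j` with eigenvalue `c_j ≠ 0`, because `[h_j, h_i]` is central.
  refine ⟨y, hy, fun i => sub_eq_zero.1 <| hψ.eq_zero_of_lie_eq_smul (x := h j) hj ?_ ?_⟩
  · have hij : ⁅⁅h j, h i⁆, y⁆ = 0 := by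
      rw [← lie_skew, hψ.lie_eq_zero_right (hh j i), neg_zero]
    rw [lie_sub, leibniz_lie, hij, hjy, lie_smul, lie_smul, hjy, smul_sub, smul_comm (c i), zero_add]
  · rw [map_sub, LieHom.map_lie, map_smul, hy, hx, sub_self]

/-- The relations that involve the `h_i` lift to central extensions. -/
lemma CartanRelations.exists_lift {M : Matrix ι ι ℤ} (hM : ∀ i, M i i ≠ 0) {g : Gen ι → L}
    (hg : CartanRelations M g) {ψ : E →ₗ⁅ℂ⁆ L} (hψ : IsCentralExtension ψ) :
    ∃ G : Gen ι → E, (∀ a, ψ (G a) = g a) ∧ CartanRelations M G := by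
  choose s hs using hψ.surjective
  have hMC : ∀ i, (M i i : ℂ) ≠ 0 := fun i => Int.cast_ne_zero.2 (hM i)
  -- Uncorrected lifts suffice to define `h_i`: replacing them by the eigenvectors found below
  -- leaves their bracket unchanged.
  let h : ι → E := fun i => ⁅s (g (.e i)), s (g (.f i))⁆
  have hh : ∀ i, ψ (h i) = g (.h i) := fun i => by
    rw [LieHom.map_lie, hs, hs, hg.lie_e_f]
  have hcomm : ∀ i j, ψ ⁅h i, h j⁆ = 0 := fun i j => by rw [LieHom.map_lie, hh, hh, hg.lie_h_h]
  have hE : ∀ j, ∃ y : E, ψ y = g (.e j) ∧ ∀ i, ⁅h i, y⁆ = (M i j : ℂ) • y := fun j =>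
    hψ.exists_lift_eigenvector hcomm (fun i => by rw [hh, hg.lie_h_e]) (hMC j)
  have hF : ∀ j, ∃ y : E, ψ y = g (.f j) ∧ ∀ i, ⁅h i, y⁆ = -(M i j : ℂ) • y := fun j =>
    hψ.exists_lift_eigenvector hcomm (c := fun i => -(M i j : ℂ))
      (fun i => by rw [hh, hg.lie_h_f]) (neg_ne_zero.2 (hMC j))
  choose e he heh using hE
  choose f hf hfh using hF
  refine ⟨fun | .e i => e i | .f i => f i | .h i => h i, ?_, ?_, ?_, ?_⟩
  · rintro (i | i | i)
    exacts [he i, hf i, hh i]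
  · exact fun i j => heh j i
  · exact fun i j => hfh j i
  · exact fun i => hψ.lie_congr (by rw [he, hs]) (by rw [hf, hs])

end Chevalley

/-! ### Weights -/

section Weight

variable {r : ℕ} {ι : Type} {ρ : ι → Fin r → ℤ} {E : Type u} [LieRing E] [LieAlgebra ℂ E]

lemma dotProduct_self_pos {x : Fin r → ℤ} (hx : x ∈ rootsB r) : 0 < x ⬝ᵥ x := by
  rcases hx with ⟨i, j, s, t, hij, rfl⟩ | ⟨i, s, rfl⟩
  · rcases Int.units_eq_one_or s with rfl | rfl <;>
      rcases Int.units_eq_one_or t with rfl | rfl <;> simp [hij, hij.symm]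
  · rcases Int.units_eq_one_or s with rfl | rfl <;> simp

/-- Integer division is additive here because it is exact when `x` is a root. -/
lemma cartanInt_add {x : Fin r → ℤ} (hx : x ∈ rootsB r) (y z : Fin r → ℤ) :
    cartanInt x (y + z) = cartanInt x y + cartanInt x z := by
  refine mul_right_cancel₀ (dotProduct_self_pos hx).ne' ?_
  rw [add_mul, cartanInt_mul_self hx, cartanInt_mul_self hx, cartanInt_mul_self hx,
    dotProduct_add, mul_add]

lemma cartanInt_neg {x : Fin r → ℤ} (hx : x ∈ rootsB r) (y : Fin r → ℤ) :
    cartanInt x (-y) = -cartanInt x y := by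
  refine mul_right_cancel₀ (dotProduct_self_pos hx).ne' ?_
  rw [neg_mul, cartanInt_mul_self hx, cartanInt_mul_self hx, dotProduct_neg, mul_neg]

lemma cartanInt_zero (x : Fin r → ℤ) : cartanInt x 0 = 0 := by
  simp [cartanInt]

lemma cartanInt_nsmul {x : Fin r → ℤ} (hx : x ∈ rootsB r) (n : ℕ) (y : Fin r → ℤ) :
    cartanInt x (n • y) = n * cartanInt x y := by
  induction n with
  | zero => simp [cartanInt_zero]
  | succ n ih => rw [succ_nsmul, cartanInt_add hx, ih]; push_cast; ring

lemma cartanInt_self {x : Fin r → ℤ} (hx : x ∈ rootsB r) : cartanInt x x = 2 :=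
  mul_right_cancel₀ (dotProduct_self_pos hx).ne' (cartanInt_mul_self hx x)

/-- A base of the root system of type `B_r` separates the points of the lattice. -/
lemma IsBase.exists_cartanInt_ne_zero {α : Fin r → Fin r → ℤ} (hα : IsBase α) {γ : Fin r → ℤ}
    (hγ : γ ≠ 0) : ∃ i, cartanInt (α i) γ ≠ 0 := by
  by_contra! h
  have hdot : ∀ i, α i ⬝ᵥ γ = 0 := fun i => by
    have := cartanInt_mul_self (hα.mem i) γ
    rw [h i] at this
    linarith
  have hcl : ∀ x ∈ AddSubmonoid.closure (Set.range α), x ⬝ᵥ γ = 0 := by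
    intro x hx
    induction hx using AddSubmonoid.closure_induction with
    | mem x hx => obtain ⟨i, rfl⟩ := hx; exact hdot i
    | zero => exact zero_dotProduct γ
    | add x y _ _ hx hy => rw [add_dotProduct, hx, hy, add_zero]
  refine hγ (funext fun k => ?_)
  -- The short root `ε_k` or its negative is a sum of simple roots, so the `k`-th coordinate of `γ`
  -- vanishes.
  rcases hα.mem_or_neg_mem (Pi.single k 1) (Or.inr ⟨k, 1, by simp⟩) with hk | hk
  · simpa using hcl _ hk
  · simpa using hcl _ hk

/-- `x` is a simultaneous eigenvector for the `h_i`, with the eigenvalues of an element of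
degree `γ`. -/
def HasWeight (ρ : ι → Fin r → ℤ) (G : Gen ι → E) (γ : Fin r → ℤ) (x : E) : Prop :=
  ∀ i, ⁅G (.h i), x⁆ = (cartanInt (ρ i) γ : ℂ) • x

lemma HasWeight.lie (hρ : ∀ i, ρ i ∈ rootsB r) {G : Gen ι → E} {γ δ : Fin r → ℤ} {x y : E}
    (hx : HasWeight ρ G γ x) (hy : HasWeight ρ G δ y) : HasWeight ρ G (γ + δ) ⁅x, y⁆ := fun i => by
  rw [leibniz_lie, hx i, hy i, smul_lie, lie_smul, ← add_smul, cartanInt_add (hρ i), Int.cast_add]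

lemma HasWeight.ad_pow (hρ : ∀ i, ρ i ∈ rootsB r) {G : Gen ι → E} {γ δ : Fin r → ℤ} {x y : E}
    (hx : HasWeight ρ G γ x) (hy : HasWeight ρ G δ y) (n : ℕ) :
    HasWeight ρ G (n • γ + δ) ((LieAlgebra.ad ℂ E x ^ n) y) := by
  induction n with
  | zero => simpa using hy
  | succ n ih =>
    rw [pow_succ', Module.End.mul_apply, LieAlgebra.ad_apply, succ_nsmul', add_assoc]
    exact hx.lie hρ ih

lemma HasWeight.eq_zero {L : Type v} [LieRing L] [LieAlgebra ℂ L] {ψ : E →ₗ⁅ℂ⁆ L}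
    (hψ : IsCentralExtension ψ) {G : Gen ι → E} {γ : Fin r → ℤ} {x : E} (hx : HasWeight ρ G γ x)
    (i : ι) (hi : cartanInt (ρ i) γ ≠ 0) (h : ψ x = 0) : x = 0 :=
  hψ.eq_zero_of_lie_eq_smul (Int.cast_ne_zero.2 hi) (hx i) h

lemma CartanRelations.hasWeight (hρ : ∀ i, ρ i ∈ rootsB r) {G : Gen ι → E}
    (hG : CartanRelations (cartanIntMatrix ρ) G) (a : Gen ι) :
    HasWeight ρ G (a.degree ρ) (G a) := by
  intro i
  cases a with
  | e j => exact hG.lie_h_e i j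
  | f j => rw [Gen.degree, cartanInt_neg (hρ i), Int.cast_neg]; exact hG.lie_h_f i j
  | h j => rw [hG.lie_h_h, Gen.degree, cartanInt_zero, Int.cast_zero, zero_smul]

end Weight

/-! ### The presentation of `im` -/

section Presentation

variable {r : ℕ} {ι : Type} {ρ : ι → Fin r → ℤ}

lemma map_freeAd_pow {E : Type u} [LieRing E] [LieAlgebra ℂ E]
    (Φ : FreeLieAlgebra ℂ (Gen ι) →ₗ⁅ℂ⁆ E) (x y : FreeLieAlgebra ℂ (Gen ι)) (n : ℕ) :
    Φ ((freeAd x ^ n) y) = (LieAlgebra.ad ℂ E (Φ x) ^ n) (Φ y) := by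
  induction n with
  | zero => simp
  | succ n ih =>
    rw [pow_succ', pow_succ', Module.End.mul_apply, Module.End.mul_apply, LieAlgebra.ad_apply,
      LieAlgebra.ad_apply, LieHom.map_lie, ih]

lemma quotientMk_relator {M : Matrix ι ι ℤ} {x : FreeLieAlgebra ℂ (Gen ι)} (hx : IsRelator M x) :
    quotientMk (relationIdeal M) x = 0 :=
  quotientMk_eq_zero.2 (LieSubmodule.subset_lieSpan hx)

/-- The projection of the free Lie algebra onto `im`. -/
noncomputable def IM.proj (ρ : ι → Fin r → ℤ) : FreeLieAlgebra ℂ (Gen ι) →ₗ⁅ℂ⁆ IM ρ :=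
  (quotientMk (radical ρ)).comp (quotientMk (relationIdeal (cartanIntMatrix ρ)))

lemma IM.proj_surjective (ρ : ι → Fin r → ℤ) : Function.Surjective (IM.proj ρ) :=
  (quotientMk_surjective _).comp (quotientMk_surjective _)

/-- The class in `im` of a generator. -/
noncomputable def IM.gen (ρ : ι → Fin r → ℤ) (a : Gen ι) : IM ρ :=
  IM.proj ρ (FreeLieAlgebra.of ℂ a)

lemma IM.proj_relator {x : FreeLieAlgebra ℂ (Gen ι)} (hx : IsRelator (cartanIntMatrix ρ) x) :
    IM.proj ρ x = 0 := by
  rw [IM.proj, LieHom.comp_apply, quotientMk_relator hx, map_zero]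

lemma IM.cartanRelations (ρ : ι → Fin r → ℤ) :
    CartanRelations (cartanIntMatrix ρ) (IM.gen ρ) where
  lie_h_e i j := by
    have := IM.proj_relator (IsRelator.he (M := cartanIntMatrix ρ) i j)
    rwa [map_sub, LieHom.map_lie, map_smul, sub_eq_zero] at this
  lie_h_f i j := by
    have := IM.proj_relator (IsRelator.hf (M := cartanIntMatrix ρ) i j)
    rwa [map_add, LieHom.map_lie, map_smul, add_eq_zero_iff_eq_neg, ← neg_smul] at this
  lie_e_f i := by
    have := IM.proj_relator (IsRelator.ef (M := cartanIntMatrix ρ) i)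
    rwa [map_sub, LieHom.map_lie, sub_eq_zero] at this

lemma IM.perfect (hρ : ∀ i, ρ i ∈ rootsB r) :
    ⁅(⊤ : LieIdeal ℂ (IM ρ)), (⊤ : LieIdeal ℂ (IM ρ))⁆ = ⊤ := by
  have hlie : ∀ x y : IM ρ, ⁅x, y⁆ ∈ ⁅(⊤ : LieIdeal ℂ (IM ρ)), (⊤ : LieIdeal ℂ (IM ρ))⁆ :=
    fun x y => LieSubmodule.lie_mem_lie (LieSubmodule.mem_top x) (LieSubmodule.mem_top y)
  have hrel := IM.cartanRelations ρ
  have hself : ∀ j, (cartanIntMatrix ρ j j : ℂ) ≠ 0 := fun j => by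
    rw [cartanIntMatrix, cartanInt_self (hρ j)]; norm_num
  have hgen : ∀ a, IM.gen ρ a ∈ ⁅(⊤ : LieIdeal ℂ (IM ρ)), (⊤ : LieIdeal ℂ (IM ρ))⁆ := by
    rintro (j | j | j)
    · have := hlie (IM.gen ρ (.h j)) (IM.gen ρ (.e j))
      rw [hrel.lie_h_e] at this
      exact (Submodule.smul_mem_iff _ (hself j)).1 this
    · have := hlie (IM.gen ρ (.h j)) (IM.gen ρ (.f j))
      rw [hrel.lie_h_f] at this
      exact (Submodule.smul_mem_iff _ (neg_ne_zero.2 (hself j))).1 this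
    · rw [← hrel.lie_e_f]
      exact hlie _ _
  -- The quotient of `im` by its derived algebra receives zero from every generator, so the
  -- projection onto it is zero.
  have hzero : (quotientMk ⁅(⊤ : LieIdeal ℂ (IM ρ)), (⊤ : LieIdeal ℂ (IM ρ))⁆).comp
      (IM.proj ρ) = 0 :=
    FreeLieAlgebra.hom_ext fun a => quotientMk_eq_zero.2 (hgen a)
  rw [eq_top_iff]
  intro x _
  obtain ⟨y, rfl⟩ := IM.proj_surjective ρ x
  exact quotientMk_eq_zero.1 (LieHom.congr_fun hzero y)

/-- If a lift of the projection onto `im` to a central extension respects the relations that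
involve the `h_i`, then it respects all defining relations of `gim`. -/
lemma map_relator_eq_zero (hρ : ∀ i, ρ i ∈ rootsB r) {E : Type u} [LieRing E] [LieAlgebra ℂ E]
    {ψ : E →ₗ⁅ℂ⁆ IM ρ} (hψ : IsCentralExtension ψ) {G : Gen ι → E}
    (hG : CartanRelations (cartanIntMatrix ρ) G)
    (hlift : ∀ x, ψ (FreeLieAlgebra.lift ℂ G x) = IM.proj ρ x)
    {x : FreeLieAlgebra ℂ (Gen ι)} (hx : IsRelator (cartanIntMatrix ρ) x) :
    FreeLieAlgebra.lift ℂ G x = 0 := by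
  have h0 : ψ (FreeLieAlgebra.lift ℂ G x) = 0 := by rw [hlift, IM.proj_relator hx]
  have hw := hG.hasWeight hρ
  -- In every case below without an `h`, the eigenvalue of `h_i` on the relator is `±(2 + |M_ij|)`.
  -- For the powers of `ad`, the exponent `|M_ij| + 1` contributes `±2(|M_ij| + 1)` and the other
  -- factor contributes `∓|M_ij|`.
  have hc : ∀ i (n : ℕ) (δ : Fin r → ℤ), cartanInt (ρ i) (n • ρ i + δ) =
      2 * n + cartanInt (ρ i) δ := fun i n δ => by
    rw [cartanInt_add (hρ i), cartanInt_nsmul (hρ i), cartanInt_self (hρ i), mul_comm]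
  have hcn : ∀ i (n : ℕ) (δ : Fin r → ℤ), cartanInt (ρ i) (n • (-ρ i) + δ) =
      -(2 * n) + cartanInt (ρ i) δ := fun i n δ => by
    rw [cartanInt_add (hρ i), cartanInt_nsmul (hρ i), cartanInt_neg (hρ i), cartanInt_self (hρ i)]
    ring
  cases hx with
  | he i j =>
    rw [map_sub, LieHom.map_lie, map_smul, FreeLieAlgebra.lift_of_apply,
      FreeLieAlgebra.lift_of_apply, hG.lie_h_e, sub_self]
  | hf i j =>
    rw [map_add, LieHom.map_lie, map_smul, FreeLieAlgebra.lift_of_apply,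
      FreeLieAlgebra.lift_of_apply, hG.lie_h_f, neg_smul, neg_add_cancel]
  | ef i =>
    rw [map_sub, LieHom.map_lie, FreeLieAlgebra.lift_of_apply, FreeLieAlgebra.lift_of_apply,
      FreeLieAlgebra.lift_of_apply, hG.lie_e_f, sub_self]
  | neg_ef i j hM =>
    rw [LieHom.map_lie, FreeLieAlgebra.lift_of_apply, FreeLieAlgebra.lift_of_apply] at h0 ⊢
    refine ((hw _).lie hρ (hw _)).eq_zero hψ i ?_ h0
    rw [cartanIntMatrix] at hM
    rw [cartanInt_add (hρ i), Gen.degree, Gen.degree, cartanInt_neg (hρ i), cartanInt_self (hρ i)]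
    omega
  | neg_fe i j hM =>
    rw [LieHom.map_lie, FreeLieAlgebra.lift_of_apply, FreeLieAlgebra.lift_of_apply] at h0 ⊢
    refine ((hw _).lie hρ (hw _)).eq_zero hψ i ?_ h0
    rw [cartanIntMatrix] at hM
    rw [cartanInt_add (hρ i), Gen.degree, Gen.degree, cartanInt_neg (hρ i), cartanInt_self (hρ i)]
    omega
  | neg_ad_e i j hM =>
    rw [map_freeAd_pow, FreeLieAlgebra.lift_of_apply, FreeLieAlgebra.lift_of_apply] at h0 ⊢
    refine ((hw _).ad_pow hρ (hw _) _).eq_zero hψ i ?_ h0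
    rw [cartanIntMatrix] at hM ⊢
    rw [Gen.degree, Gen.degree, hc]
    omega
  | neg_ad_f i j hM =>
    rw [map_freeAd_pow, FreeLieAlgebra.lift_of_apply, FreeLieAlgebra.lift_of_apply] at h0 ⊢
    refine ((hw _).ad_pow hρ (hw _) _).eq_zero hψ i ?_ h0
    rw [cartanIntMatrix] at hM ⊢
    rw [Gen.degree, Gen.degree, hcn, cartanInt_neg (hρ i)]
    omega
  | pos_ee i j hM =>
    rw [LieHom.map_lie, FreeLieAlgebra.lift_of_apply, FreeLieAlgebra.lift_of_apply] at h0 ⊢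
    refine ((hw _).lie hρ (hw _)).eq_zero hψ i ?_ h0
    rw [cartanIntMatrix] at hM
    rw [cartanInt_add (hρ i), Gen.degree, Gen.degree, cartanInt_self (hρ i)]
    omega
  | pos_ff i j hM =>
    rw [LieHom.map_lie, FreeLieAlgebra.lift_of_apply, FreeLieAlgebra.lift_of_apply] at h0 ⊢
    refine ((hw _).lie hρ (hw _)).eq_zero hψ i ?_ h0
    rw [cartanIntMatrix] at hM
    rw [cartanInt_add (hρ i), Gen.degree, Gen.degree, cartanInt_neg (hρ i), cartanInt_neg (hρ i),
      cartanInt_self (hρ i)]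
    omega
  | pos_ad_e i j hM =>
    rw [map_freeAd_pow, FreeLieAlgebra.lift_of_apply, FreeLieAlgebra.lift_of_apply] at h0 ⊢
    refine ((hw _).ad_pow hρ (hw _) _).eq_zero hψ i ?_ h0
    rw [cartanIntMatrix] at hM ⊢
    rw [Gen.degree, Gen.degree, hc, cartanInt_neg (hρ i)]
    omega
  | pos_ad_f i j hM =>
    rw [map_freeAd_pow, FreeLieAlgebra.lift_of_apply, FreeLieAlgebra.lift_of_apply] at h0 ⊢
    refine ((hw _).ad_pow hρ (hw _) _).eq_zero hψ i ?_ h0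
    rw [cartanIntMatrix] at hM ⊢
    rw [Gen.degree, Gen.degree, hcn]
    omega

/-- A homomorphism from `gim` maps monomials of degree `γ` to vectors of weight `γ`. -/
lemma IsMonomial.hasWeight (hρ : ∀ i, ρ i ∈ rootsB r) {E : Type u} [LieRing E] [LieAlgebra ℂ E]
    {G : Gen ι → E} (hG : CartanRelations (cartanIntMatrix ρ) G)
    {Θ : GIM (cartanIntMatrix ρ) →ₗ⁅ℂ⁆ E} (hΘ : ∀ a, Θ (GIM.gen _ a) = G a)
    {γ : Fin r → ℤ} {x : GIM (cartanIntMatrix ρ)} (hx : IsMonomial ρ (cartanIntMatrix ρ) γ x) :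
    HasWeight ρ G γ (Θ x) := by
  induction hx with
  | gen a => rw [hΘ]; exact hG.hasWeight hρ a
  | lie _ _ hx hy => rw [LieHom.map_lie]; exact hx.lie hρ hy

/-- Central extensions of `im` split, when the family of roots separates the points of the
lattice. -/
theorem IM.exists_section (hρ : ∀ i, ρ i ∈ rootsB r)
    (hsep : ∀ γ : Fin r → ℤ, γ ≠ 0 → ∃ i, cartanInt (ρ i) γ ≠ 0)
    {E : Type u} [LieRing E] [LieAlgebra ℂ E] {ψ : E →ₗ⁅ℂ⁆ IM ρ} (hψ : IsCentralExtension ψ) :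
    ∃ θ : IM ρ →ₗ⁅ℂ⁆ E, ψ.comp θ = LieHom.id := by
  obtain ⟨G, hψG, hG⟩ := (IM.cartanRelations ρ).exists_lift
    (fun i => by rw [cartanIntMatrix, cartanInt_self (hρ i)]; norm_num) hψ
  have hlift : ψ.comp (FreeLieAlgebra.lift ℂ G) = IM.proj ρ :=
    FreeLieAlgebra.hom_ext fun a => by
      rw [LieHom.comp_apply, FreeLieAlgebra.lift_of_apply]
      exact hψG a
  have hrel : relationIdeal (cartanIntMatrix ρ) ≤ (FreeLieAlgebra.lift ℂ G).ker :=
    LieSubmodule.lieSpan_le.2 fun x hx =>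
      LieHom.mem_ker.2 (map_relator_eq_zero hρ hψ hG (LieHom.congr_fun hlift) hx)
  let Θ := quotientLift _ (FreeLieAlgebra.lift ℂ G) hrel
  have hΘ : ∀ a, Θ (GIM.gen _ a) = G a := fun a => FreeLieAlgebra.lift_of_apply G a
  have hψΘ : ∀ x, ψ (Θ x) = quotientMk (radical ρ) x := fun x => by
    obtain ⟨y, rfl⟩ := quotientMk_surjective _ x
    exact LieHom.congr_fun hlift y
  have hrad : radical ρ ≤ Θ.ker := by
    refine LieSubmodule.lieSpan_le.2 ?_
    rintro x ⟨γ, hγ, hx⟩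
    -- Degree zero is excluded from the generators of the radical, so some `h_i` has a nonzero
    -- eigenvalue in degree `γ`.
    obtain ⟨i, hi⟩ := hsep γ fun h => hγ (Or.inr h)
    have hx0 : ψ (Θ x) = 0 :=
      (hψΘ x).trans (quotientMk_eq_zero.2 (LieSubmodule.subset_lieSpan ⟨γ, hγ, hx⟩))
    have hw : HasWeight ρ G γ (Θ x) := by
      unfold homogeneousPart at hx
      intro j
      clear hx0
      induction hx using Submodule.span_induction with
      | mem x hx => exact IsMonomial.hasWeight hρ hG hΘ hx j
      | zero => simp
      | add x y _ _ hx hy => rw [map_add, lie_add, hx, hy, smul_add]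
      | smul c x _ hx => rw [map_smul, lie_smul, hx, smul_comm]
    exact LieHom.mem_ker.2 (hw.eq_zero hψ i hi hx0)
  refine ⟨quotientLift _ Θ hrad, LieHom.ext fun x => ?_⟩
  obtain ⟨y, rfl⟩ := quotientMk_surjective _ x
  exact hψΘ y

end Presentation

/-- An intersection matrix algebra is centrally closed if its roots separate the points of the
lattice. -/
theorem IM.isCentrallyClosed {r : ℕ} {ι : Type} {ρ : ι → Fin r → ℤ} (hρ : ∀ i, ρ i ∈ rootsB r)
    (hsep : ∀ γ : Fin r → ℤ, γ ≠ 0 → ∃ i, cartanInt (ρ i) γ ≠ 0) :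
    IsCentrallyClosed.{0, w} (IM ρ) where
  perfect := IM.perfect hρ
  isCentralExtension :=
    { surjective := Function.surjective_id
      ker_le_center := fun x hx => by
        have hx0 : x = 0 := LieHom.mem_ker.1 hx
        rw [hx0]
        exact zero_mem _ }
  existsUnique_lift E _ _ ψ hψ := by
    obtain ⟨θ, hθ⟩ := IM.exists_section hρ hsep hψ
    exact ⟨θ, hθ, fun θ' hθ' => hψ.lift_unique (IM.perfect hρ) (hθ'.trans hθ.symm)⟩

end IntersectionMatrix

open IntersectionMatrix in
/-- Let `r ≥ 3`, let `α` be an ordered base of the root system of type `B_r`, and adjoin `d` long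
roots `μ_1, …, μ_d`, repetitions allowed. Then the intersection matrix algebra `im(A^[d])` is
centrally closed. -/
theorem theorem1 (r d : ℕ) (hr : 3 ≤ r) (α : Fin r → Fin r → ℤ) (hα : IsBase α)
    (μ : Fin d → Fin r → ℤ) (hμ : ∀ k, μ k ∈ longRoots r) :
    IsCentrallyClosed.{0, w} (IM (Sum.elim α μ)) := by
  refine IM.isCentrallyClosed ?_ fun γ hγ => ?_
  · rintro (i | k)
    exacts [hα.mem i, Or.inl (hμ k)]
  -- The base alone already separates; the adjoined roots need not contribute.
  · obtain ⟨i, hi⟩ := hα.exists_cartanInt_ne_zero hγ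
    exact ⟨Sum.inl i, hi⟩
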